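/- **Setting.** All manifolds, maps, vector fields and distributions are smooth ($C^\infty$), and manifolds are finite-dimensional without boundary. Let $(M,E,g_M)$ be a quaternionic Kähler manifold: $E$ is a rank 3 subbundle of $\operatorname{End}(TM)$ such that every point of $M$ has an open neighbourhood on which $E$ has a *quaternionic Hermitian basis*, i.e. a basis of smooth sections $\{J_1,J_2,J_3\}$ with (indices modulo $3$) $$J_\alpha^2=-\mathrm{id},\qquad J_\alpha J_{\alpha+1}=-J_{\alpha+1}J_\alpha=J_{\alpha+2},\qquad g_M(J_\alpha X,J_\alpha Y)=g_M(X,Y),$$ which moreover satisfies $\nabla_XJ_\alpha=\omega_{\alpha+2}(X)J_{\alpha+1}-\omega_{\alpha+1}(X)J_{\alpha+2}$ for some local $1$-forms $\omega_1,\omega_2,\omega_3$, where $\nabla$ is the Levi-Civita connection of $g_M$. Let $(N,g_N)$ be a Riemannian manifold with $\dim N<\dim M$, and let $F:M\to N$ be an *h-conformal submersion*: $F$ is a smooth surjective map whose differential $F_*$ is surjective at every point, and there is a function $\lambda:M\to(0,\infty)$ with $g_N(F_*V,F_*W)=\lambda(p)^2g_M(V,W)$ for all $p\in M$ and $V,W\in(\ker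 F_{*p})^\perp$. For an open set $U\subseteq M$, a quaternionic Hermitian basis $\{J_1,J_2,J_3\}$ of $E$ on $U$ is called an *h-conformal semi-invariant basis* if there is a distribution $\mathcal D_1\subseteq\ker F_*$ on $U$ such that for every $R\in\{J_1,J_2,J_3\}$ $$R(\mathcal D_1)=\mathcal D_1,\qquad R(\mathcal D_2)\subseteq(\ker F_*)^\perp,$$ where $\mathcal D_2$ is the orthogonal complement of $\mathcal D_1$ in $\ker F_*$. Suppose that $F$ is an *h-conformal semi-invariant submersion*, i.e. that every point of $M$ has an open neighbourhood on which such a basis exists. For $R\in\{J_1,J_2,J_3\}$ let $\mu^R$ be the orthogonal complement of $R\mathcal D_2$ in $(\ker F_*)^\perp$. The second fundamental form of $F$ is $(\nabla F_*)(X,Y)=\nabla^N_XF_*Y-F_*(\nabla_XY)$, where $\nabla^N$ is the connection on $F^{-1}TN$ induced by the Levi-Civita connection of $g_N$. A distribution $\mathcal D$ is called integrable if $[X,Y]\in\Gamma(\mathcal D)$ for all $X,Y\in\Gamma(\mathcal D)$. **Lemma.** Let $F:(M,E,g_M)\to(N,g_N)$ be an h-conformal semi-invariant submersion from a quaternionic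 Kähler manifold onto a Riemannian manifold, and let $\{J_1,J_2,J_3\}$ be an h-conformal semi-invariant basis on an open set $U\subseteq M$, with distributions $\mathcal D_1$ and $\mathcal D_2$. Then, on $U$: (i) The distribution $\mathcal D_2$ is integrable. (ii) The following conditions are equivalent: (a) the distribution $\mathcal D_1$ is integrable; (b) $(\nabla F_*)(Z,J_1Y)-(\nabla F_*)(Y,J_1Z)\in\Gamma(F_*\mu^{J_1})$ for all $Y,Z\in\Gamma(\mathcal D_1)$; (c) $(\nabla F_*)(Z,J_2Y)-(\nabla F_*)(Y,J_2Z)\in\Gamma(F_*\mu^{J_2})$ for all $Y,Z\in\Gamma(\mathcal D_1)$; (d) $(\nabla F_*)(Z,J_3Y)-(\nabla F_*)(Y,J_3Z)\in\Gamma(F_*\mu^{J_3})$ for all $Y,Z\in\Gamma(\mathcal D_1)$. -/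

import Mathlib

open Bundle Manifold ContDiff VectorField FiberBundle

noncomputable section

namespace HConformal

/-! ### The Levi-Civita connection -/

section LeviCivita

variable {E : Type*} [NormedAddCommGroup E] [NormedSpace ℝ E] [FiniteDimensional ℝ E]
  {H : Type*} [TopologicalSpace H] {I : ModelWithCorners ℝ E H}
  {M : Type*} [TopologicalSpace M] [ChartedSpace H M] [IsManifold I ∞ M]

set_option linter.unusedSectionVars false in
theorem mdifferentiableAt_inner
    (g : ContMDiffRiemannianMetric I ∞ E (fun x : M ↦ TangentSpace I x))
    {Y Z : Π x : M, TangentSpace I x} {x : M}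
    (hY : MDiffAt (T% Y) x) (hZ : MDiffAt (T% Z) x) :
    MDiffAt (fun y ↦ g.inner y (Y y) (Z y)) x := by
  have : MDifferentiableAt I (I.prod 𝓘(ℝ))
      (fun m ↦ TotalSpace.mk' ℝ (E := Bundle.Trivial M ℝ) m (g.inner m (Y m) (Z m))) x := by
    apply MDifferentiableAt.clm_bundle_apply₂ (F₁ := E) (F₂ := E)
    · exact (g.contMDiff x).mdifferentiableAt (by simp)
    · exact hY
    · exact hZ
  simp only [mdifferentiableAt_totalSpace] at this
  exact this.2

/-- The right-hand side of the Koszul formula for `g(∇_X Y, Z)`: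
`½ (X g(Y,Z) + Y g(X,Z) - Z g(X,Y) + g([X,Y],Z) - g([X,Z],Y) - g([Y,Z],X))`. -/
def koszul (g : ContMDiffRiemannianMetric I ∞ E (fun x : M ↦ TangentSpace I x))
    (Y X Z : Π x : M, TangentSpace I x) (x : M) : ℝ :=
  (1 / 2 : ℝ) *
    (d% (fun y ↦ g.inner y (Y y) (Z y)) x (X x) + d% (fun y ↦ g.inner y (X y) (Z y)) x (Y x)
      - d% (fun y ↦ g.inner y (X y) (Y y)) x (Z x)
      + g.inner x (mlieBracket I X Y x) (Z x) - g.inner x (mlieBracket I X Z x) (Y x)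
      - g.inner x (mlieBracket I Y Z x) (X x))

variable (g : ContMDiffRiemannianMetric I ∞ E (fun x : M ↦ TangentSpace I x))

theorem koszul_tensorial_left {Y Z : Π x : M, TangentSpace I x} {x : M}
    (hY : MDiffAt (T% Y) x) (hZ : MDiffAt (T% Z) x) :
    TensorialAt I E (fun X ↦ koszul g Y X Z x) x where
  smul {f X} hf hX := by
    have e (W : Π x : M, TangentSpace I x) : (fun y ↦ g.inner y ((f • X) y) (W y))
        = fun y ↦ f y * g.inner y (X y) (W y) := by ext y; simp
    simp only [koszul, mlieBracket_smul_left hf hX, e]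
    rw [mvfderiv_fun_mul hf (mdifferentiableAt_inner g hX hZ),
      mvfderiv_fun_mul hf (mdifferentiableAt_inner g hX hY)]
    simp
    ring
  add {X X'} hX hX' := by
    have e (W : Π x : M, TangentSpace I x) : (fun y ↦ g.inner y ((X + X') y) (W y))
        = fun y ↦ g.inner y (X y) (W y) + g.inner y (X' y) (W y) := by ext y; simp
    simp only [koszul, mlieBracket_add_left hX hX', e]
    rw [mvfderiv_fun_add (mdifferentiableAt_inner g hX hZ) (mdifferentiableAt_inner g hX' hZ),
      mvfderiv_fun_add (mdifferentiableAt_inner g hX hY) (mdifferentiableAt_inner g hX' hY)]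
    simp
    ring

theorem koszul_tensorial_right {Y X : Π x : M, TangentSpace I x} {x : M}
    (hY : MDiffAt (T% Y) x) (hX : MDiffAt (T% X) x) :
    TensorialAt I E (fun Z ↦ koszul g Y X Z x) x where
  smul {f Z} hf hZ := by
    have e (W : Π x : M, TangentSpace I x) : (fun y ↦ g.inner y (W y) ((f • Z) y))
        = fun y ↦ f y * g.inner y (W y) (Z y) := by ext y; simp
    simp only [koszul, mlieBracket_smul_right hf hZ, e]
    rw [mvfderiv_fun_mul hf (mdifferentiableAt_inner g hX hZ),
      mvfderiv_fun_mul hf (mdifferentiableAt_inner g hY hZ)]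
    simp [g.symm x (Z x) (Y x), g.symm x (Z x) (X x)]
    ring
  add {Z Z'} hZ hZ' := by
    have e (W : Π x : M, TangentSpace I x) : (fun y ↦ g.inner y (W y) ((Z + Z') y))
        = fun y ↦ g.inner y (W y) (Z y) + g.inner y (W y) (Z' y) := by ext y; simp
    simp only [koszul, mlieBracket_add_right hZ hZ', e]
    rw [mvfderiv_fun_add (mdifferentiableAt_inner g hX hZ) (mdifferentiableAt_inner g hX hZ'),
      mvfderiv_fun_add (mdifferentiableAt_inner g hY hZ) (mdifferentiableAt_inner g hY hZ')]
    simp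
    ring

theorem koszul_add {Y Y' X Z : Π x : M, TangentSpace I x} {x : M}
    (hY : MDiffAt (T% Y) x) (hY' : MDiffAt (T% Y') x)
    (hX : MDiffAt (T% X) x) (hZ : MDiffAt (T% Z) x) :
    koszul g (Y + Y') X Z x = koszul g Y X Z x + koszul g Y' X Z x := by
  have e (W : Π x : M, TangentSpace I x) : (fun y ↦ g.inner y (W y) ((Y + Y') y))
      = fun y ↦ g.inner y (W y) (Y y) + g.inner y (W y) (Y' y) := by ext y; simp
  have e' (W : Π x : M, TangentSpace I x) : (fun y ↦ g.inner y ((Y + Y') y) (W y))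
      = fun y ↦ g.inner y (Y y) (W y) + g.inner y (Y' y) (W y) := by ext y; simp
  simp only [koszul, mlieBracket_add_right hY hY', mlieBracket_add_left hY hY', e, e']
  rw [mvfderiv_fun_add (mdifferentiableAt_inner g hX hY) (mdifferentiableAt_inner g hX hY'),
    mvfderiv_fun_add (mdifferentiableAt_inner g hY hZ) (mdifferentiableAt_inner g hY' hZ)]
  simp
  ring

theorem koszul_smul {Y X Z : Π x : M, TangentSpace I x} {f : M → ℝ} {x : M}
    (hY : MDiffAt (T% Y) x) (hf : MDiffAt f x)
    (hX : MDiffAt (T% X) x) (hZ : MDiffAt (T% Z) x) :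
    koszul g (f • Y) X Z x = f x * koszul g Y X Z x + d% f x (X x) * g.inner x (Y x) (Z x) := by
  have e (W : Π x : M, TangentSpace I x) : (fun y ↦ g.inner y (W y) ((f • Y) y))
      = fun y ↦ f y * g.inner y (W y) (Y y) := by ext y; simp
  have e' (W : Π x : M, TangentSpace I x) : (fun y ↦ g.inner y ((f • Y) y) (W y))
      = fun y ↦ f y * g.inner y (Y y) (W y) := by ext y; simp
  simp only [koszul, mlieBracket_smul_right hf hY, mlieBracket_smul_left hf hY, e, e']
  rw [mvfderiv_fun_mul hf (mdifferentiableAt_inner g hX hY),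
    mvfderiv_fun_mul hf (mdifferentiableAt_inner g hY hZ)]
  simp [g.symm x (X x) (Y x)]
  ring

theorem exists_inner_eq (x : M) (φ : TangentSpace I x →L[ℝ] ℝ) :
    ∃ v : TangentSpace I x, ∀ w, g.inner x v w = φ w := by
  have : FiniteDimensional ℝ (TangentSpace I x) := inferInstanceAs (FiniteDimensional ℝ E)
  let L : TangentSpace I x →ₗ[ℝ] Module.Dual ℝ (TangentSpace I x) :=
    { toFun := fun v ↦ (g.inner x v : TangentSpace I x →ₗ[ℝ] ℝ)
      map_add' := fun v w ↦ by ext; simp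
      map_smul' := fun c v ↦ by ext; simp }
  have hL : Function.Injective L := by
    rw [injective_iff_map_eq_zero]
    intro v hv
    by_contra h
    have := g.pos x v h
    have h2 : L v v = 0 := by rw [hv]; rfl
    exact this.ne' h2
  have hs : Function.Surjective L :=
    (LinearMap.injective_iff_surjective_of_finrank_eq_finrank
      (Subspace.dual_finrank_eq).symm).1 hL
  obtain ⟨v, hv⟩ := hs (φ : TangentSpace I x →ₗ[ℝ] ℝ)
  exact ⟨v, fun w ↦ LinearMap.congr_fun hv w⟩

set_option linter.unusedSectionVars false in
theorem inner_left_injective {x : M} {v v' : TangentSpace I x}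
    (h : ∀ w, g.inner x v w = g.inner x v' w) : v = v' := by
  by_contra hne
  have := g.pos x (v - v') (sub_ne_zero.2 hne)
  simp [h] at this

theorem exists_koszul_eq {Y : Π x : M, TangentSpace I x} {x : M} (hY : MDiffAt (T% Y) x) :
    ∃ L : TangentSpace I x →L[ℝ] TangentSpace I x, ∀ X Z : Π x : M, TangentSpace I x,
      MDiffAt (T% X) x → MDiffAt (T% Z) x →
        g.inner x (L (X x)) (Z x) = koszul g Y X Z x := by
  have : FiniteDimensional ℝ (TangentSpace I x) := inferInstanceAs (FiniteDimensional ℝ E)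
  let Φ : TangentSpace I x →L[ℝ] TangentSpace I x →L[ℝ] ℝ :=
    TensorialAt.mkHom₂ (fun X Z ↦ koszul g Y X Z x) x
      (fun _ hZ ↦ koszul_tensorial_left g hY hZ) (fun _ hX ↦ koszul_tensorial_right g hY hX)
  have : T2Space (TangentSpace I x) := inferInstanceAs (T2Space E)
  choose s hs using exists_inner_eq g x
  let L : TangentSpace I x →ₗ[ℝ] TangentSpace I x :=
    { toFun := fun u ↦ s (Φ u)
      map_add' := fun u v ↦ inner_left_injective g fun w ↦ by simp [hs]
      map_smul' := fun c v ↦ inner_left_injective g fun w ↦ by simp [hs] }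
  refine ⟨LinearMap.toContinuousLinearMap L, fun X Z hX hZ ↦ ?_⟩
  calc g.inner x (s (Φ (X x))) (Z x) = Φ (X x) (Z x) := hs _ _
    _ = koszul g Y X Z x := TensorialAt.mkHom₂_apply _ _ hX hZ

open Classical in
/-- `leviCivitaFun g Y x u` is `(∇_u Y)(x)`, the vector determined by the Koszul formula;
it is set to `0` when `Y` is not differentiable at `x`. -/
def leviCivitaFun (Y : Π x : M, TangentSpace I x) (x : M) :
    TangentSpace I x →L[ℝ] TangentSpace I x :=
  if hY : MDiffAt (T% Y) x then (exists_koszul_eq g hY).choose else 0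

theorem inner_leviCivitaFun {X Y Z : Π x : M, TangentSpace I x} {x : M}
    (hX : MDiffAt (T% X) x) (hY : MDiffAt (T% Y) x) (hZ : MDiffAt (T% Z) x) :
    g.inner x (leviCivitaFun g Y x (X x)) (Z x) = koszul g Y X Z x := by
  rw [leviCivitaFun, dif_pos hY]
  exact (exists_koszul_eq g hY).choose_spec X Z hX hZ

/-- The Levi-Civita connection of a Riemannian metric; `leviCivita g Y x (X x)` is
`(∇_X Y)(x)`. -/
def leviCivita : CovariantDerivative I E (TangentSpace I : M → Type _) where
  toFun := leviCivitaFun g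
  isCovariantDerivativeOnUniv :=
    { add := by
        intro Y Y' x hY hY' _
        ext u
        refine inner_left_injective g fun w ↦ ?_
        have hu := mdifferentiableAt_extend I E u
        have hw := mdifferentiableAt_extend I E w
        have h₁ := inner_leviCivitaFun g hu (mdifferentiableAt_add_section hY hY') hw
        have h₂ := inner_leviCivitaFun g hu hY hw
        have h₃ := inner_leviCivitaFun g hu hY' hw
        have h₄ := koszul_add g hY hY' hu hw
        simp only [extend_apply_self] at h₁ h₂ h₃
        simp only [add_apply, map_add, h₂, h₃, ← h₄]
        exact h₁
      leibniz := by
        intro Y f x hY hf _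
        ext u
        refine inner_left_injective g fun w ↦ ?_
        have hu := mdifferentiableAt_extend I E u
        have hw := mdifferentiableAt_extend I E w
        have h₁ := inner_leviCivitaFun g hu (hf.smul_section hY) hw
        have h₂ := inner_leviCivitaFun g hu hY hw
        have h₄ := koszul_smul g hY hf hu hw
        simp only [extend_apply_self] at h₁ h₂ h₄
        simp only [add_apply, map_add, smul_apply,
          map_smul, smul_eq_mul, ContinuousLinearMap.smulRight_apply, h₂, ← h₄]
        exact h₁ }

theorem leviCivita_torsion : (leviCivita g).torsion = 0 := by
  rw [CovariantDerivative.torsion_eq_zero_iff]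
  intro X Y x hX hY
  refine inner_left_injective g fun w ↦ ?_
  have hw := mdifferentiableAt_extend I E w
  have h₁ := inner_leviCivitaFun g hX hY hw
  have h₂ := inner_leviCivitaFun g hY hX hw
  simp only [extend_apply_self, koszul] at h₁ h₂
  simp only [map_sub, sub_apply]
  change g.inner x (leviCivitaFun g Y x (X x)) w - g.inner x (leviCivitaFun g X x (Y x)) w = _
  have e : (fun y ↦ g.inner y (X y) (Y y)) = fun y ↦ g.inner y (Y y) (X y) := by
    ext y; exact g.symm _ _ _
  rw [h₁, h₂, e, mlieBracket_swap_apply (V := Y) (W := X)]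
  simp
  ring

theorem leviCivita_metric {X Y Z : Π x : M, TangentSpace I x} {x : M}
    (hX : MDiffAt (T% X) x) (hY : MDiffAt (T% Y) x) (hZ : MDiffAt (T% Z) x) :
    d% (fun y ↦ g.inner y (Y y) (Z y)) x (X x) =
      g.inner x (leviCivita g Y x (X x)) (Z x) + g.inner x (Y x) (leviCivita g Z x (X x)) := by
  have h₁ := inner_leviCivitaFun g hX hY hZ
  have h₂ := inner_leviCivitaFun g hX hZ hY
  rw [g.symm x (Y x)]
  change _ = g.inner x (leviCivitaFun g Y x (X x)) (Z x)
    + g.inner x (leviCivitaFun g Z x (X x)) (Y x)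
  have e (A B : Π x : M, TangentSpace I x) :
      (fun y ↦ g.inner y (A y) (B y)) = fun y ↦ g.inner y (B y) (A y) := by
    ext y; exact g.symm _ _ _
  rw [h₁, h₂, koszul, koszul, e Z Y, e X Z, e X Y, mlieBracket_swap_apply (V := Z) (W := Y)]
  simp
  ring

end LeviCivita

variable {E : Type*} [NormedAddCommGroup E] [NormedSpace ℝ E] [FiniteDimensional ℝ E]
  {H : Type*} [TopologicalSpace H] {I : ModelWithCorners ℝ E H}
  {M : Type*} [TopologicalSpace M] [ChartedSpace H M] [IsManifold I ∞ M]
  {E' : Type*} [NormedAddCommGroup E'] [NormedSpace ℝ E'] [FiniteDimensional ℝ E']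
  {H' : Type*} [TopologicalSpace H'] {I' : ModelWithCorners ℝ E' H'}
  {N : Type*} [TopologicalSpace N] [ChartedSpace H' N] [IsManifold I' ∞ N]

/-! ### The second fundamental form of a map -/

section SecondFundamentalForm

variable (I) in
/-- The connection induced by a connection `cov` of `TN` on the pull-back bundle `F⁻¹TN`.
In the frame `e₁, …, eₙ` of `TN` near `F x` given by the chart at `F x`, a section
`V = ∑ᵢ Vⁱ (eᵢ ∘ F)` has the derivative
`∇_u V = ∑ᵢ u(Vⁱ) eᵢ(F x) + ∑ᵢ Vⁱ(x) (∇_{F_* u} eᵢ)(F x)` at `x`. Here `y ↦ (e ⟨F y, V y⟩).2` is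
the vector of the coefficients `Vⁱ`, and `extend E' (V x)` is the field `∑ᵢ Vⁱ(x) eᵢ`. -/
def pullbackCov (cov : CovariantDerivative I' E' (TangentSpace I' : N → Type _))
    (F : M → N) (V : Π x : M, TangentSpace I' (F x)) (x : M) :
    TangentSpace I x →L[ℝ] TangentSpace I' (F x) :=
  letI e := trivializationAt E' (TangentSpace I' : N → Type _) (F x)
  e.symmL ℝ (F x) ∘L mvfderiv I (fun y ↦ (e ⟨F y, V y⟩).2) x
    + cov (extend E' (V x)) (F x) ∘L mfderiv I I' F x

/-- The second fundamental form `(∇F_*)(X, Y) = ∇^F_X (F_* Y) - F_* (∇_X Y)` of `F`, at `x`. -/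
def secondFundamentalForm
    (gM : ContMDiffRiemannianMetric I ∞ E (fun x : M ↦ TangentSpace I x))
    (gN : ContMDiffRiemannianMetric I' ∞ E' (fun x : N ↦ TangentSpace I' x))
    (F : M → N) (X Y : Π x : M, TangentSpace I x) (x : M) : TangentSpace I' (F x) :=
  pullbackCov I (leviCivita gN) F (fun y ↦ mfderiv I I' F y (Y y)) x (X x)
    - mfderiv I I' F x (leviCivita gM Y x (X x))

end SecondFundamentalForm

/-! ### Distributions -/

section Distributions

/-- `D` is a smooth distribution (a smooth vector subbundle of `TM`) on `U`: locally it has a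
frame of smooth vector fields. -/
def IsSmoothDistributionOn (D : Π x : M, Submodule ℝ (TangentSpace I x)) (U : Set M) : Prop :=
  ∀ p ∈ U, ∃ V : Set M, IsOpen V ∧ p ∈ V ∧ V ⊆ U ∧
    ∃ (k : ℕ) (X : Fin k → Π x : M, TangentSpace I x),
      (∀ i, ContMDiffOn I I.tangent ∞ (T% (X i)) V) ∧
      ∀ x ∈ V, LinearIndependent ℝ (fun i ↦ X i x) ∧
        Submodule.span ℝ (Set.range fun i ↦ X i x) = D x

/-- `X ∈ Γ(D)` over `U`: a smooth vector field on `U` with values in `D`. -/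
def IsSectionOn (D : Π x : M, Submodule ℝ (TangentSpace I x)) (U : Set M)
    (X : Π x : M, TangentSpace I x) : Prop :=
  ContMDiffOn I I.tangent ∞ (T% X) U ∧ ∀ x ∈ U, X x ∈ D x

/-- `D` is integrable on `U`: `[X, Y] ∈ Γ(D)` for all `X, Y ∈ Γ(D)`. -/
def IsIntegrableOn (D : Π x : M, Submodule ℝ (TangentSpace I x)) (U : Set M) : Prop :=
  ∀ X Y : Π x : M, TangentSpace I x, IsSectionOn D U X → IsSectionOn D U Y →
    ∀ x ∈ U, mlieBracket I X Y x ∈ D x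

/-- The orthogonal complement of a subspace of a tangent space. -/
def perp (g : ContMDiffRiemannianMetric I ∞ E (fun x : M ↦ TangentSpace I x)) {x : M}
    (S : Submodule ℝ (TangentSpace I x)) : Submodule ℝ (TangentSpace I x) where
  carrier := {v | ∀ w ∈ S, g.inner x v w = 0}
  add_mem' hv hv' w hw := by simp [hv w hw, hv' w hw]
  zero_mem' w _ := by simp
  smul_mem' c v hv w hw := by simp [hv w hw]

variable (I I') in
/-- The vertical distribution `ker F_*`. -/
def vertical (F : M → N) (x : M) : Submodule ℝ (TangentSpace I x) :=
  LinearMap.ker (mfderiv I I' F x).toLinearMap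

variable (I') in
/-- The horizontal distribution `(ker F_*)^⊥`. -/
def horizontal (g : ContMDiffRiemannianMetric I ∞ E (fun x : M ↦ TangentSpace I x))
    (F : M → N) (x : M) : Submodule ℝ (TangentSpace I x) :=
  perp g (vertical I I' F x)

variable (I') in
/-- The orthogonal complement `D₂` of `D₁` in `ker F_*`. -/
def complementInVertical (g : ContMDiffRiemannianMetric I ∞ E (fun x : M ↦ TangentSpace I x))
    (F : M → N) (D₁ : Π x : M, Submodule ℝ (TangentSpace I x)) (x : M) :
    Submodule ℝ (TangentSpace I x) :=
  vertical I I' F x ⊓ perp g (D₁ x)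

variable (I') in
/-- The orthogonal complement `μ^R` of `R D₂` in `(ker F_*)^⊥`. -/
def mu (g : ContMDiffRiemannianMetric I ∞ E (fun x : M ↦ TangentSpace I x))
    (F : M → N) (D₁ : Π x : M, Submodule ℝ (TangentSpace I x))
    (R : Π x : M, TangentSpace I x →L[ℝ] TangentSpace I x) (x : M) :
    Submodule ℝ (TangentSpace I x) :=
  horizontal I' g F x ⊓
    perp g ((complementInVertical I' g F D₁ x).map (R x).toLinearMap)

end Distributions

/-! ### Quaternionic Kähler manifolds -/

section Quaternionic

/-- `J 0, J 1, J 2` (the indices being modulo `3`) is a quaternionic Hermitian basis, over `U`, of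
the family `Q` of spaces of endomorphisms of the tangent spaces. -/
structure IsQuaternionicHermitianBasis
    (g : ContMDiffRiemannianMetric I ∞ E (fun x : M ↦ TangentSpace I x))
    (Q : Π x : M, Submodule ℝ (TangentSpace I x →L[ℝ] TangentSpace I x)) (U : Set M)
    (J : Fin 3 → Π x : M, TangentSpace I x →L[ℝ] TangentSpace I x) : Prop where
  smooth : ∀ α, ContMDiffOn I (I.prod 𝓘(ℝ, E →L[ℝ] E)) ∞
    (fun x ↦ TotalSpace.mk' (E →L[ℝ] E)
      (E := fun x : M ↦ TangentSpace I x →L[ℝ] TangentSpace I x) x (J α x)) U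
  linearIndependent : ∀ x ∈ U, LinearIndependent ℝ (fun α ↦ J α x)
  span_eq : ∀ x ∈ U, Submodule.span ℝ (Set.range fun α ↦ J α x) = Q x
  sq : ∀ x ∈ U, ∀ α v, J α x (J α x v) = -v
  mul : ∀ x ∈ U, ∀ α v, J α x (J (α + 1) x v) = J (α + 2) x v
  mul_swap : ∀ x ∈ U, ∀ α v, J (α + 1) x (J α x v) = -J (α + 2) x v
  hermitian : ∀ x ∈ U, ∀ α v w, g.inner x (J α x v) (J α x w) = g.inner x v w

/-- `(M, Q, g)` is a quaternionic Kähler manifold: near every point, `Q` has a quaternionic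
Hermitian basis with
`∇_X J_α = θ_{α+2}(X) J_{α+1} - θ_{α+1}(X) J_{α+2}` for smooth 1-forms `θ₀, θ₁, θ₂`, where
`(∇_X J_α) Y = ∇_X (J_α Y) - J_α (∇_X Y)`. -/
def IsQuaternionicKahler
    (g : ContMDiffRiemannianMetric I ∞ E (fun x : M ↦ TangentSpace I x))
    (Q : Π x : M, Submodule ℝ (TangentSpace I x →L[ℝ] TangentSpace I x)) : Prop :=
  ∀ p : M, ∃ U : Set M, IsOpen U ∧ p ∈ U ∧
    ∃ J : Fin 3 → Π x : M, TangentSpace I x →L[ℝ] TangentSpace I x,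
      IsQuaternionicHermitianBasis g Q U J ∧
      ∃ θ : Fin 3 → Π x : M, TangentSpace I x →L[ℝ] ℝ,
        (∀ α, ContMDiffOn I (I.prod 𝓘(ℝ, E →L[ℝ] ℝ)) ∞
          (fun x ↦ TotalSpace.mk' (E →L[ℝ] ℝ)
            (E := fun x : M ↦ TangentSpace I x →L[ℝ] Bundle.Trivial M ℝ x) x (θ α x)) U) ∧
        ∀ α, ∀ x ∈ U, ∀ Y : Π x : M, TangentSpace I x,
          ContMDiffAt I I.tangent ∞ (T% Y) x → ∀ u : TangentSpace I x,
            leviCivita g (fun y ↦ J α y (Y y)) x u - J α x (leviCivita g Y x u) =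
              θ (α + 2) x u • J (α + 1) x (Y x) - θ (α + 1) x u • J (α + 2) x (Y x)

end Quaternionic

/-! ### h-conformal semi-invariant submersions -/

section Submersions

/-- `F` is a horizontally conformal submersion of `(M, gM)` onto `(N, gN)`, with a dilation
`lam`. -/
structure IsHConformalSubmersion
    (gM : ContMDiffRiemannianMetric I ∞ E (fun x : M ↦ TangentSpace I x))
    (gN : ContMDiffRiemannianMetric I' ∞ E' (fun x : N ↦ TangentSpace I' x))
    (F : M → N) : Prop where
  finrank_lt : Module.finrank ℝ E' < Module.finrank ℝ E
  smooth : ContMDiff I I' ∞ F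
  surjective : Function.Surjective F
  surjective_mfderiv : ∀ x, Function.Surjective (mfderiv I I' F x)
  conformal : ∃ lam : M → ℝ, (∀ x, 0 < lam x) ∧
    ∀ x, ∀ v ∈ horizontal I' gM F x, ∀ w ∈ horizontal I' gM F x,
      gN.inner (F x) (mfderiv I I' F x v) (mfderiv I I' F x w) = lam x ^ 2 * gM.inner x v w

variable (I') in
/-- Over `U`, `J` is an h-conformal semi-invariant basis of `Q`, with the distribution
`D₁ ⊆ ker F_*`. -/
structure IsHConformalSemiInvariantBasis
    (gM : ContMDiffRiemannianMetric I ∞ E (fun x : M ↦ TangentSpace I x))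
    (Q : Π x : M, Submodule ℝ (TangentSpace I x →L[ℝ] TangentSpace I x))
    (F : M → N) (U : Set M)
    (J : Fin 3 → Π x : M, TangentSpace I x →L[ℝ] TangentSpace I x)
    (D₁ : Π x : M, Submodule ℝ (TangentSpace I x)) : Prop where
  basis : IsQuaternionicHermitianBasis gM Q U J
  distribution : IsSmoothDistributionOn D₁ U
  le_vertical : ∀ x ∈ U, D₁ x ≤ vertical I I' F x
  map_eq : ∀ x ∈ U, ∀ α, (D₁ x).map (J α x).toLinearMap = D₁ x
  map_le : ∀ x ∈ U, ∀ α,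
    (complementInVertical I' gM F D₁ x).map (J α x).toLinearMap ≤ horizontal I' gM F x

/-- `F` is an h-conformal semi-invariant submersion from `(M, Q, gM)` onto `(N, gN)`. -/
structure IsHConformalSemiInvariantSubmersion
    (gM : ContMDiffRiemannianMetric I ∞ E (fun x : M ↦ TangentSpace I x))
    (gN : ContMDiffRiemannianMetric I' ∞ E' (fun x : N ↦ TangentSpace I' x))
    (Q : Π x : M, Submodule ℝ (TangentSpace I x →L[ℝ] TangentSpace I x))
    (F : M → N) : Prop extends IsHConformalSubmersion gM gN F where
  exists_basis : ∀ p : M, ∃ U : Set M, IsOpen U ∧ p ∈ U ∧ ∃ J D₁,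
    IsHConformalSemiInvariantBasis I' gM Q F U J D₁

variable (I') in
/-- `(∇F_*)(Z, R Y) - (∇F_*)(Y, R Z) ∈ Γ(F_* μ^R)` over `U`, for all `Y, Z ∈ Γ(D₁)`. -/
def SecondFundamentalFormCondition
    (gM : ContMDiffRiemannianMetric I ∞ E (fun x : M ↦ TangentSpace I x))
    (gN : ContMDiffRiemannianMetric I' ∞ E' (fun x : N ↦ TangentSpace I' x))
    (F : M → N) (U : Set M) (D₁ : Π x : M, Submodule ℝ (TangentSpace I x))
    (R : Π x : M, TangentSpace I x →L[ℝ] TangentSpace I x) : Prop :=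
  ∀ Y Z : Π x : M, TangentSpace I x, IsSectionOn D₁ U Y → IsSectionOn D₁ U Z → ∀ x ∈ U,
    secondFundamentalForm gM gN F Z (fun y ↦ R y (Y y)) x
        - secondFundamentalForm gM gN F Y (fun y ↦ R y (Z y)) x ∈
      (mu I' gM F D₁ R x).map (mfderiv I I' F x).toLinearMap

end Submersions

end HConformal

end

/-! The connection preserves `Q`: `(∇_u J_α) W = T W` with `T ∈ Q`
(`exists_leviCivita_apply_sub_eq`). Since elements of `Q` are combinations of the `J_α`, they map
`D₁` into `D₁` and `D₂` into the horizontal space. The error term `T W` therefore drops out of every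
pairing below, and `J_α` can be moved through `∇` as on a Kähler manifold. The bracket of two
vertical fields is vertical (`mfderiv_mlieBracket_eq_zero`), so it lies in one of `D₁`, `D₂` as soon
as it is orthogonal to the other.

(i) Let `Y, Z ∈ Γ(D₂)`, `X` a local section of `D₁`, and `J = J₀`. As `JZ` and `JY` are horizontal,
`g(∇_Y Z, JX) = g(JZ, ∇_Y X) = g(JZ, ∇_X Y) = g(JY, ∇_X Z) = g(JY, ∇_Z X) = g(∇_Z Y, JX)`. The
second and fourth equalities hold because `[Y, X]` and `[Z, X]` are vertical. Thus `g([Y, Z], JX) =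
0`, and `J D₁ = D₁`.

(ii) Let `Y, Z ∈ Γ(D₁)`. As `JY` and `JZ` are vertical, the expression in the condition for `J =
J_α` is `F_*(∇_Y JZ - ∇_Z JY)` (`secondFundamentalForm_of_vertical`). It lies in `F_* μ^J` iff `∇_Y
JZ - ∇_Z JY` is orthogonal to `J D₂` (`mfderiv_mem_map_mu_iff`). Its pairing with `Jv`, for `v ∈
D₂`, is `g([Y, Z], v)`, so each of the three conditions says that `[Y, Z] ∈ D₁`. -/

namespace HConformal

open Filter Topology

set_option linter.unusedSectionVars false

/-! ### Brackets of vertical fields -/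

section LieBracket

variable {E : Type*} [NormedAddCommGroup E] [NormedSpace ℝ E] [FiniteDimensional ℝ E]
  {M : Type*} [TopologicalSpace M] [ChartedSpace E M] [IsManifold 𝓘(ℝ, E) ∞ M]
  {E' : Type*} [NormedAddCommGroup E'] [NormedSpace ℝ E']
  {N : Type*} [TopologicalSpace N] [ChartedSpace E' N] [IsManifold 𝓘(ℝ, E') ∞ N]

/-- The bracket of two vector fields killed by the differential of a map is killed by it. -/
theorem mfderiv_mlieBracket_eq_zero {f : M → N} (hf : ContMDiff 𝓘(ℝ, E) 𝓘(ℝ, E') ∞ f)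
    {V W : Π x : M, TangentSpace 𝓘(ℝ, E) x} {x : M}
    (hV : MDiffAt (T% V) x) (hW : MDiffAt (T% W) x)
    (hV₀ : ∀ᶠ y in 𝓝 x, mfderiv 𝓘(ℝ, E) 𝓘(ℝ, E') f y (V y) = 0)
    (hW₀ : ∀ᶠ y in 𝓝 x, mfderiv 𝓘(ℝ, E) 𝓘(ℝ, E') f y (W y) = 0) :
    mfderiv 𝓘(ℝ, E) 𝓘(ℝ, E') f x (mlieBracket 𝓘(ℝ, E) V W x) = 0 := by
  have : IsManifold 𝓘(ℝ, E) 2 M := inferInstance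
  have : IsManifold 𝓘(ℝ, E) 1 M := IsManifold.of_le (n := ∞) (by simp)
  have : IsManifold 𝓘(ℝ, E') 1 N := IsManifold.of_le (n := ∞) (by simp)
  set φ := extChartAt 𝓘(ℝ, E) x with hφ
  set ψ := extChartAt 𝓘(ℝ, E') (f x) with hψ
  set fh : E → E' := ψ ∘ f ∘ φ.symm with hfh
  have hfh_smooth : ContDiffAt ℝ ∞ fh (φ x) := by
    have := (contMDiffAt_iff.1 (hf x)).2
    simpa only [modelWithCornersSelf_coe, Set.range_id, contDiffWithinAt_univ] using this
  have hψf : ∀ᶠ y in 𝓝 x, MDifferentiableAt 𝓘(ℝ, E') 𝓘(ℝ, E') ψ (f y) := by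
    filter_upwards [(hf.continuous.continuousAt (x := x)).preimage_mem_nhds
      ((chartAt E' (f x)).open_source.mem_nhds (mem_chart_source E' (f x)))] with y hy
    exact mdifferentiableAt_extChartAt hy
  -- By the chain rule, `d fh` of the coordinate field is `dψ (df X) = 0`, on a whole neighbourhood,
  -- so that this identity can be differentiated.
  have hker (X : Π x : M, TangentSpace 𝓘(ℝ, E) x)
      (hX₀ : ∀ᶠ y in 𝓝 x, mfderiv 𝓘(ℝ, E) 𝓘(ℝ, E') f y (X y) = 0) :
      ∀ᶠ u in 𝓝 (φ x), fderiv ℝ fh u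
        (mpullbackWithin 𝓘(ℝ, E) 𝓘(ℝ, E) φ.symm X (Set.range 𝓘(ℝ, E)) u) = 0 := by
    have hc : Tendsto φ.symm (𝓝 (φ x)) (𝓝 x) := by
      have := continuousAt_extChartAt_symm (I := 𝓘(ℝ, E)) x
      rwa [ContinuousAt, extChartAt_to_inv] at this
    filter_upwards [hc.eventually hX₀, hc.eventually hψf,
      extChartAt_target_mem_nhds (I := 𝓘(ℝ, E)) x] with u hu hu' hut
    have hs : MDifferentiableAt 𝓘(ℝ, E) 𝓘(ℝ, E) φ.symm u := by
      have := mdifferentiableWithinAt_extChartAt_symm (I := 𝓘(ℝ, E)) hut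
      simpa only [modelWithCornersSelf_coe, Set.range_id, mdifferentiableWithinAt_univ] using this
    have hfd : MDifferentiableAt 𝓘(ℝ, E) 𝓘(ℝ, E') f (φ.symm u) :=
      (hf _).mdifferentiableAt (by simp)
    have hinv := isInvertible_mfderivWithin_extChartAt_symm (I := 𝓘(ℝ, E)) hut
    have e : mfderiv 𝓘(ℝ, E) 𝓘(ℝ, E) φ.symm u
        (mpullbackWithin 𝓘(ℝ, E) 𝓘(ℝ, E) φ.symm X (Set.range 𝓘(ℝ, E)) u) = X (φ.symm u) := by
      rw [mpullbackWithin_apply, ← mfderivWithin_univ]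
      simp only [modelWithCornersSelf_coe, Set.range_id] at hinv ⊢
      exact hinv.self_apply_inverse _
    have e₁ := mfderiv_comp_apply (I' := 𝓘(ℝ, E')) (g := ψ) (f := f ∘ φ.symm) u hu'
      (hfd.comp u hs) (mpullbackWithin 𝓘(ℝ, E) 𝓘(ℝ, E) φ.symm X (Set.range 𝓘(ℝ, E)) u)
    rw [mfderiv_comp_apply (I' := 𝓘(ℝ, E)) (g := f) (f := φ.symm) u hfd hs, e, hu, map_zero] at e₁
    rw [← mfderiv_eq_fderiv]
    exact e₁
  have hd (X : Π x : M, TangentSpace 𝓘(ℝ, E) x) (hX : MDiffAt (T% X) x) :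
      DifferentiableAt ℝ (mpullbackWithin 𝓘(ℝ, E) 𝓘(ℝ, E) φ.symm X (Set.range 𝓘(ℝ, E)))
        (φ x) := by
    rw [← mdifferentiableWithinAt_univ] at hX
    have := hX.differentiableWithinAt_mpullbackWithin_vectorField
    simp only [modelWithCornersSelf_coe, Set.range_id, Set.preimage_univ, Set.inter_univ] at this ⊢
    exact differentiableWithinAt_univ.1 this
  -- By the symmetry of the second derivative, `d fh [V, W]` is the derivative of `d fh W` along `V`
  -- minus that of `d fh V` along `W`; both functions vanish near `φ x`.
  have hb : fderiv ℝ fh (φ x) (lieBracket ℝ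
      (mpullbackWithin 𝓘(ℝ, E) 𝓘(ℝ, E) φ.symm V (Set.range 𝓘(ℝ, E)))
      (mpullbackWithin 𝓘(ℝ, E) 𝓘(ℝ, E) φ.symm W (Set.range 𝓘(ℝ, E))) (φ x)) = 0 := by
    have h0 (X : E → E) (hX : ∀ᶠ u in 𝓝 (φ x), fderiv ℝ fh u (X u) = 0) :
        fderiv ℝ (fun u ↦ fderiv ℝ fh u (X u)) (φ x) = 0 := by
      have : (fun u ↦ fderiv ℝ fh u (X u)) =ᶠ[𝓝 (φ x)] fun _ ↦ 0 := hX
      rw [this.fderiv_eq]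
      simp
    rw [fderiv_apply_lieBracket hfh_smooth
      (by simpa using ENat.LEInfty.out) (hd W hW) (hd V hV), h0 _ (hker V hV₀), h0 _ (hker W hW₀)]
    exact sub_zero _
  have hbr : mfderiv 𝓘(ℝ, E) 𝓘(ℝ, E) φ x (mlieBracket 𝓘(ℝ, E) V W x) = lieBracket ℝ
      (mpullbackWithin 𝓘(ℝ, E) 𝓘(ℝ, E) φ.symm V (Set.range 𝓘(ℝ, E)))
      (mpullbackWithin 𝓘(ℝ, E) 𝓘(ℝ, E) φ.symm W (Set.range 𝓘(ℝ, E))) (φ x) := by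
    rw [← mlieBracketWithin_univ, mlieBracketWithin_apply]
    refine ((isInvertible_mfderiv_extChartAt
      (mem_extChartAt_source x)).self_apply_inverse _).trans ?_
    simp only [modelWithCornersSelf_coe, Set.range_id, Set.preimage_univ, Set.inter_univ]
    exact congrFun (lieBracketWithin_univ (𝕜 := ℝ) (E := E)) _
  have hcomp : mfderiv 𝓘(ℝ, E) 𝓘(ℝ, E') (fh ∘ φ) x = mfderiv 𝓘(ℝ, E) 𝓘(ℝ, E') (ψ ∘ f) x := by
    apply EventuallyEq.mfderiv_eq
    filter_upwards [extChartAt_source_mem_nhds (I := 𝓘(ℝ, E)) x] with y hy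
    simp only [hfh, Function.comp_apply]
    rw [φ.left_inv hy]
  have h1 := congr($hcomp (mlieBracket 𝓘(ℝ, E) V W x))
  rw [mfderiv_comp_apply (I' := 𝓘(ℝ, E)) x
      (hfh_smooth.differentiableAt (by simp)).mdifferentiableAt
      (mdifferentiableAt_extChartAt (mem_chart_source E x)),
    mfderiv_comp_apply (I' := 𝓘(ℝ, E')) x hψf.self_of_nhds ((hf x).mdifferentiableAt (by simp)),
    hbr, mfderiv_eq_fderiv] at h1
  have hinj := (isInvertible_mfderiv_extChartAt (I := 𝓘(ℝ, E'))
    (mem_extChartAt_source (f x))).injective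
  apply hinj
  rw [map_zero]
  exact h1.symm.trans hb

end LieBracket

/-! ### Pointwise linear algebra of the splitting and of the quaternionic structure -/

section Linear

variable {E : Type*} [NormedAddCommGroup E] [NormedSpace ℝ E] [FiniteDimensional ℝ E]
  {H : Type*} [TopologicalSpace H] {I : ModelWithCorners ℝ E H}
  {M : Type*} [TopologicalSpace M] [ChartedSpace H M] [IsManifold I ∞ M]
  {E' : Type*} [NormedAddCommGroup E'] [NormedSpace ℝ E']
  {H' : Type*} [TopologicalSpace H'] {I' : ModelWithCorners ℝ E' H'}
  {N : Type*} [TopologicalSpace N] [ChartedSpace H' N]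
  (g : ContMDiffRiemannianMetric I ∞ E (fun x : M ↦ TangentSpace I x))

theorem inner_self_eq_zero {x : M} {v : TangentSpace I x} : g.inner x v v = 0 ↔ v = 0 := by
  refine ⟨fun h ↦ ?_, fun h ↦ by simp [h]⟩
  by_contra hv
  exact (g.pos x v hv).ne' h

/-- Orthogonal decomposition of a tangent vector along a subspace. -/
theorem exists_mem_sub_mem_perp {x : M} (S : Submodule ℝ (TangentSpace I x))
    (w : TangentSpace I x) : ∃ v ∈ S, w - v ∈ perp g S := by
  have : FiniteDimensional ℝ (TangentSpace I x) := inferInstanceAs (FiniteDimensional ℝ E)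
  -- By positivity `v ↦ g(v, ·)` is injective from `S` to its dual, hence onto by dimension; the
  -- projection of `w` represents `g(w, ·)` on `S`.
  let L : S →ₗ[ℝ] Module.Dual ℝ S :=
    { toFun := fun v ↦ (g.inner x v : TangentSpace I x →ₗ[ℝ] ℝ) ∘ₗ S.subtype
      map_add' := fun v w ↦ by ext; simp
      map_smul' := fun c v ↦ by ext; simp }
  have hL : Function.Injective L := by
    rw [injective_iff_map_eq_zero]
    intro v hv
    exact Subtype.ext ((inner_self_eq_zero g).1 (LinearMap.congr_fun hv v))
  have hs : Function.Surjective L :=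
    (LinearMap.injective_iff_surjective_of_finrank_eq_finrank
      (Subspace.dual_finrank_eq).symm).1 hL
  obtain ⟨v, hv⟩ := hs ((g.inner x w : TangentSpace I x →ₗ[ℝ] ℝ) ∘ₗ S.subtype)
  refine ⟨v, v.2, fun z hz ↦ ?_⟩
  have h : g.inner x v z = g.inner x w z := LinearMap.congr_fun hv ⟨z, hz⟩
  simp [h]

theorem inner_eq_zero_of_mem_vertical_of_mem_horizontal {F : M → N} {x : M}
    {v w : TangentSpace I x} (hv : v ∈ vertical I I' F x) (hw : w ∈ horizontal I' g F x) :
    g.inner x v w = 0 := by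
  rw [g.symm]
  exact hw v hv

/-- A vertical vector lies in `D₁` iff it is orthogonal to the complement of `D₁`. -/
theorem mem_iff_forall_complementInVertical {F : M → N}
    {D₁ : Π x : M, Submodule ℝ (TangentSpace I x)} {x : M} (hD : D₁ x ≤ vertical I I' F x)
    {w : TangentSpace I x} (hw : w ∈ vertical I I' F x) :
    w ∈ D₁ x ↔ ∀ v ∈ complementInVertical I' g F D₁ x, g.inner x w v = 0 := by
  refine ⟨fun h v hv ↦ by rw [g.symm]; exact hv.2 w h, fun h ↦ ?_⟩
  obtain ⟨d, hd, hr⟩ := exists_mem_sub_mem_perp g (D₁ x) w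
  -- The remainder `w - d` is vertical and orthogonal to `D₁`, so the hypothesis applies to it and
  -- makes it orthogonal to itself.
  have h₁ := h (w - d) ⟨sub_mem hw (hD hd), hr⟩
  have h₂ : g.inner x d (w - d) = 0 := by rw [g.symm]; exact hr d hd
  have h₃ : g.inner x (w - d) (w - d) = 0 := by
    rw [map_sub (g.inner x) w d, sub_apply, h₁, h₂, sub_zero]
  rw [sub_eq_zero.1 ((inner_self_eq_zero g).1 h₃)]
  exact hd

/-- Adding a vertical vector to `w` changes neither `F_* w` nor the pairing of `w` with the
horizontal vectors `R v`. So `w` may be replaced by its horizontal part, for which orthogonality to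
`R D₂` is the definition of `μ^R`. -/
theorem mfderiv_mem_map_mu_iff {F : M → N} {D₁ : Π x : M, Submodule ℝ (TangentSpace I x)}
    {R : Π x : M, TangentSpace I x →L[ℝ] TangentSpace I x} {x : M}
    (hR : (complementInVertical I' g F D₁ x).map (R x).toLinearMap ≤ horizontal I' g F x)
    (w : TangentSpace I x) :
    mfderiv I I' F x w ∈ (mu I' g F D₁ R x).map (mfderiv I I' F x).toLinearMap ↔
      ∀ v ∈ complementInVertical I' g F D₁ x, g.inner x w (R x v) = 0 := by
  constructor
  · rintro ⟨m, hm, hmw⟩ v hv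
    have hker : w - m ∈ vertical I I' F x := by
      change mfderiv I I' F x (w - m) = 0
      rw [map_sub, sub_eq_zero]
      exact hmw.symm
    have h₁ := inner_eq_zero_of_mem_vertical_of_mem_horizontal g hker (hR ⟨v, hv, rfl⟩)
    have h₂ : g.inner x m (R x v) = 0 := hm.2 _ ⟨v, hv, rfl⟩
    rw [map_sub (g.inner x) w m, sub_apply] at h₁
    change g.inner x w (R x v) - g.inner x m (R x v) = 0 at h₁
    rwa [h₂, sub_zero] at h₁
  · intro h
    obtain ⟨d, hd, hr⟩ := exists_mem_sub_mem_perp g (vertical I I' F x) w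
    refine ⟨w - d, ⟨hr, ?_⟩, ?_⟩
    · rintro _ ⟨v, hv, rfl⟩
      have h₁ := inner_eq_zero_of_mem_vertical_of_mem_horizontal g hd (hR ⟨v, hv, rfl⟩)
      rw [map_sub (g.inner x) w d, sub_apply, h₁, sub_zero]
      exact h v hv
    · change mfderiv I I' F x (w - d) = mfderiv I I' F x w
      rw [map_sub, show mfderiv I I' F x d = 0 from hd, sub_zero]

namespace IsQuaternionicHermitianBasis

variable {g} {Q : Π x : M, Submodule ℝ (TangentSpace I x →L[ℝ] TangentSpace I x)} {U : Set M}
  {J : Fin 3 → Π x : M, TangentSpace I x →L[ℝ] TangentSpace I x}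
  (h : IsQuaternionicHermitianBasis g Q U J)
include h

theorem inner_left {x : M} (hx : x ∈ U) (α : Fin 3) (v w : TangentSpace I x) :
    g.inner x (J α x v) w = -g.inner x v (J α x w) := by
  rw [← h.hermitian x hx α (J α x v) w, h.sq x hx]
  simp

theorem inner_apply_self {x : M} (hx : x ∈ U) (α : Fin 3) (v : TangentSpace I x) :
    g.inner x v (J α x v) = 0 := by
  have h₁ := h.inner_left hx α v v
  rw [g.symm] at h₁
  linarith

/-- As `J_α` is skew, `g(J_α v, J_{α+1} v) = -g(v, J_{α+2} v)`, and this is zero because `J_{α+2}`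
is skew too. -/
theorem inner_apply_apply {x : M} (hx : x ∈ U) (α β : Fin 3) (v : TangentSpace I x) :
    g.inner x (J α x v) (J β x v) = if α = β then g.inner x v v else 0 := by
  have key (α : Fin 3) : g.inner x (J α x v) (J (α + 1) x v) = 0 := by
    rw [h.inner_left hx, h.mul x hx, h.inner_apply_self hx, neg_zero]
  by_cases hαβ : α = β
  · subst hαβ
    simp [h.hermitian x hx]
  · rw [if_neg hαβ]
    -- Distinct indices modulo `3` are cyclic neighbours.
    have : β = α + 1 ∨ α = β + 1 := by revert α β; decide
    rcases this with rfl | rfl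
    · exact key α
    · rw [g.symm]
      exact key β

theorem mem {x : M} (hx : x ∈ U) (α : Fin 3) : J α x ∈ Q x := by
  rw [← h.span_eq x hx]
  exact Submodule.subset_span ⟨α, rfl⟩

/-- The coefficients of an endomorphism `T` in `Q x` in a quaternionic Hermitian basis can be read
off from the values on a nonzero vector. -/
theorem eq_sum {x : M} (hx : x ∈ U) {T : TangentSpace I x →L[ℝ] TangentSpace I x} (hT : T ∈ Q x)
    {e : TangentSpace I x} (he : g.inner x e e ≠ 0) :
    T = ∑ β, (g.inner x (T e) (J β x e) / g.inner x e e) • J β x := by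
  rw [← h.span_eq x hx, Submodule.mem_span_range_iff_exists_fun] at hT
  obtain ⟨c, rfl⟩ := hT
  refine Finset.sum_congr rfl fun β _ ↦ ?_
  congr 1
  rw [eq_div_iff he]
  simp [h.inner_apply_apply hx]

end IsQuaternionicHermitianBasis

end Linear

/-! ### The covariant derivative of a quaternionic Hermitian basis -/

section Covariant

variable {E : Type*} [NormedAddCommGroup E] [NormedSpace ℝ E] [FiniteDimensional ℝ E]
  {H : Type*} [TopologicalSpace H] {I : ModelWithCorners ℝ E H}
  {M : Type*} [TopologicalSpace M] [ChartedSpace H M] [IsManifold I ∞ M]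
  {g : ContMDiffRiemannianMetric I ∞ E (fun x : M ↦ TangentSpace I x)}
  {Q : Π x : M, Submodule ℝ (TangentSpace I x →L[ℝ] TangentSpace I x)} {U : Set M}
  {J : Fin 3 → Π x : M, TangentSpace I x →L[ℝ] TangentSpace I x}

theorem IsQuaternionicHermitianBasis.contMDiffAt_apply
    (h : IsQuaternionicHermitianBasis g Q U J) {x : M} (hU : U ∈ 𝓝 x) (α : Fin 3)
    {Y : Π x : M, TangentSpace I x} (hY : ContMDiffAt I I.tangent ∞ (T% Y) x) :
    ContMDiffAt I I.tangent ∞ (T% (fun y ↦ J α y (Y y))) x :=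
  ContMDiffAt.clm_bundle_apply (F₁ := E) (F₂ := E) ((h.smooth α).contMDiffAt hU) hY

theorem leviCivita_add {Y Z : Π x : M, TangentSpace I x} {x : M}
    (hY : MDiffAt (T% Y) x) (hZ : MDiffAt (T% Z) x) :
    leviCivita g (Y + Z) x = leviCivita g Y x + leviCivita g Z x :=
  (leviCivita g).isCovariantDerivativeOn.add hY hZ

theorem leviCivita_smul_apply {Y : Π x : M, TangentSpace I x} {f : M → ℝ} {x : M}
    (hf : MDiffAt f x) (hY : MDiffAt (T% Y) x) (u : TangentSpace I x) :
    leviCivita g (f • Y) x u = f x • leviCivita g Y x u + d% f x u • Y x := by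
  rw [(leviCivita g).isCovariantDerivativeOn.leibniz hY hf]
  rfl

theorem leviCivita_congr {Y Z : Π x : M, TangentSpace I x} {x : M}
    (hY : MDiffAt (T% Y) x) (hZ : MDiffAt (T% Z) x) (h : ∀ᶠ y in 𝓝 x, Y y = Z y) :
    leviCivita g Y x = leviCivita g Z x :=
  (leviCivita g).isCovariantDerivativeOn.congr_of_eventuallyEq hY hZ univ_mem h

/-- Differentiability of the sum is proved in the same induction, since additivity of `∇` requires
it at each step. -/
theorem leviCivita_sum_smul_apply {ι : Type*} (s : Finset ι) {Y : ι → Π x : M, TangentSpace I x}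
    {f : ι → M → ℝ} {x : M} (hf : ∀ i, MDiffAt (f i) x) (hY : ∀ i, MDiffAt (T% (Y i)) x)
    (u : TangentSpace I x) :
    MDiffAt (T% (∑ i ∈ s, f i • Y i)) x ∧ leviCivita g (∑ i ∈ s, f i • Y i) x u =
      ∑ i ∈ s, (f i x • leviCivita g (Y i) x u + d% (f i) x u • Y i x) := by
  classical
  induction s using Finset.induction_on with
  | empty =>
    simp only [Finset.sum_empty]
    refine ⟨mdifferentiableAt_zeroSection .., ?_⟩
    rw [CovariantDerivative.zero]
    rfl
  | insert i s hi ih =>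
    rw [Finset.sum_insert hi, Finset.sum_insert hi]
    have hi := (hf i).smul_section (hY i)
    refine ⟨mdifferentiableAt_add_section hi ih.1, ?_⟩
    rw [leviCivita_add hi ih.1, add_apply, leviCivita_smul_apply (hf i) (hY i), ih.2]

/-- On a quaternionic Kähler manifold, the covariant derivative of each member of a quaternionic
Hermitian basis of `Q` takes values in `Q`. -/
theorem IsQuaternionicKahler.exists_leviCivita_apply_sub_eq (hQ : IsQuaternionicKahler g Q)
    (h : IsQuaternionicHermitianBasis g Q U J) {x : M} (hU : U ∈ 𝓝 x)
    (hE : 0 < Module.finrank ℝ E) (α : Fin 3)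
    {Y : Π x : M, TangentSpace I x} (hY : ContMDiffAt I I.tangent ∞ (T% Y) x)
    (u : TangentSpace I x) :
    ∃ T ∈ Q x, leviCivita g (fun y ↦ J α y (Y y)) x u - J α x (leviCivita g Y x u) = T (Y x) := by
  obtain ⟨V, hV, hxV, J', h', θ, -, hθ⟩ := hQ x
  have hVx : V ∈ 𝓝 x := hV.mem_nhds hxV
  have : Nontrivial E := Module.finrank_pos_iff.1 hE
  obtain ⟨e₀, he₀⟩ := exists_ne (0 : E)
  -- A smooth field that is nonzero at `x`: pairing with it shows that the coefficients of `J α` in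
  -- the basis `J'` are differentiable.
  let e : Π x : M, TangentSpace I x := extend E (show TangentSpace I x from e₀)
  have hex : e x ≠ 0 := by
    change extend E (show TangentSpace I x from e₀) x ≠ 0
    rw [extend_apply_self]
    exact he₀
  have hes : ContMDiffAt I I.tangent ∞ (T% e) x := contMDiffAt_extend I E _
  have hmd {X : Π x : M, TangentSpace I x} (hX : ContMDiffAt I I.tangent ∞ (T% X) x) :
      MDiffAt (T% X) x := hX.mdifferentiableAt (by simp)
  have hee : MDiffAt (fun y ↦ g.inner y (e y) (e y)) x :=
    mdifferentiableAt_inner g (hmd hes) (hmd hes)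
  have heex : g.inner x (e x) (e x) ≠ 0 := (g.pos x _ hex).ne'
  let a : Fin 3 → M → ℝ := fun β y ↦
    g.inner y (J α y (e y)) (J' β y (e y)) * (g.inner y (e y) (e y))⁻¹
  have ha (β : Fin 3) : MDiffAt (a β) x := by
    refine MDifferentiableAt.mul (mdifferentiableAt_inner g
      (hmd (h.contMDiffAt_apply hU α hes)) (hmd (h'.contMDiffAt_apply hVx β hes))) ?_
    exact ((differentiableAt_inv heex).mdifferentiableAt).comp x hee
  have hJ'Y (β : Fin 3) : MDiffAt (T% (fun y ↦ J' β y (Y y))) x :=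
    hmd (h'.contMDiffAt_apply hVx β hY)
  have hJa : ∀ᶠ y in 𝓝 x, J α y = ∑ β, a β y • J' β y := by
    filter_upwards [hU, hVx, hee.continuousAt.eventually_ne heex] with y hyU hyV hy
    simpa only [div_eq_mul_inv] using h'.eq_sum hyV (h.mem hyU α) hy
  have hsum := leviCivita_sum_smul_apply (g := g) Finset.univ ha hJ'Y u
  have hcongr : leviCivita g (fun y ↦ J α y (Y y)) x =
      leviCivita g (∑ β, a β • fun y ↦ J' β y (Y y)) x := by
    refine leviCivita_congr (hmd (h.contMDiffAt_apply hU α hY)) hsum.1 ?_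
    filter_upwards [hJa] with y hy
    simp [hy]
  -- The Leibniz rule for `J α = ∑ β, a β • J' β`, with `∇ J' β` given by the forms `θ` of the
  -- Kähler condition.
  refine ⟨∑ β, (a β x • (θ (β + 2) x u • J' (β + 1) x - θ (β + 1) x u • J' (β + 2) x)
    + d% (a β) x u • J' β x), ?_, ?_⟩
  · refine sum_mem fun β _ ↦ add_mem ?_ ((Q x).smul_mem _ (h'.mem hxV _))
    exact (Q x).smul_mem _ (sub_mem ((Q x).smul_mem _ (h'.mem hxV _))
      ((Q x).smul_mem _ (h'.mem hxV _)))
  · rw [hcongr, hsum.2, hJa.self_of_nhds]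
    simp only [sum_apply, add_apply, smul_apply, sub_apply]
    rw [← Finset.sum_sub_distrib]
    refine Finset.sum_congr rfl fun β _ ↦ ?_
    rw [← hθ β x hxV Y hY u, smul_sub]
    abel

end Covariant

/-! ### The second fundamental form on vertical fields -/

section SecondFundamentalForm

variable {E : Type*} [NormedAddCommGroup E] [NormedSpace ℝ E] [FiniteDimensional ℝ E]
  {H : Type*} [TopologicalSpace H] {I : ModelWithCorners ℝ E H}
  {M : Type*} [TopologicalSpace M] [ChartedSpace H M] [IsManifold I ∞ M]
  {E' : Type*} [NormedAddCommGroup E'] [NormedSpace ℝ E'] [FiniteDimensional ℝ E']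
  {H' : Type*} [TopologicalSpace H'] {I' : ModelWithCorners ℝ E' H'}
  {N : Type*} [TopologicalSpace N] [ChartedSpace H' N] [IsManifold I' ∞ N]

theorem mvfderiv_congr {f f' : M → E'} {x : M} (h : f =ᶠ[𝓝 x] f') :
    mvfderiv I f x = mvfderiv I f' x := by
  ext u
  exact congr($(h.mfderiv_eq (I := I) (I' := 𝓘(ℝ, E'))) u)

/-- The induced connection annihilates the sections that vanish near the point. -/
theorem pullbackCov_eq_zero (cov : CovariantDerivative I' E' (TangentSpace I' : N → Type _))
    {F : M → N} {V : Π x : M, TangentSpace I' (F x)} {x : M} (hF : ContinuousAt F x)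
    (hV : ∀ᶠ y in 𝓝 x, V y = 0) : pullbackCov I cov F V x = 0 := by
  have h₁ : (fun y ↦ (trivializationAt E' (TangentSpace I' : N → Type _) (F x) ⟨F y, V y⟩).2)
      =ᶠ[𝓝 x] fun _ ↦ 0 := by
    have hb := (trivializationAt E' (TangentSpace I' : N → Type _) (F x)).open_baseSet.mem_nhds
      (FiberBundle.mem_baseSet_trivializationAt' (F x))
    filter_upwards [hV, hF.preimage_mem_nhds hb] with y hy hyb
    rw [hy]
    have := (trivializationAt E' (TangentSpace I' : N → Type _) (F x)).zeroSection ℝ hyb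
    exact congr(($this).2)
  have h₂ : mvfderiv I
      (fun y ↦ (trivializationAt E' (TangentSpace I' : N → Type _) (F x) ⟨F y, V y⟩).2) x = 0 := by
    rw [mvfderiv_congr h₁, mvfderiv_const]
  -- Since `V x = 0`, its extension with constant coefficients is the zero field near `F x`.
  have h₃ : cov (extend E' (V x)) (F x) = 0 := by
    have h₀ : (trivializationAt E' (TangentSpace I' : N → Type _) (F x) ⟨F x, 0⟩).2 = 0 :=
      congr($((trivializationAt E' (TangentSpace I' : N → Type _) (F x)).zeroSection ℝ
        (FiberBundle.mem_baseSet_trivializationAt' (F x))).2)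
    have hz : cov (extend E' (V x)) (F x) = cov 0 (F x) := by
      refine cov.isCovariantDerivativeOn.congr_of_eventuallyEq
        (mdifferentiableAt_extend I' E' _) (mdifferentiableAt_zeroSection ..) univ_mem ?_
      filter_upwards [(trivializationAt E' (TangentSpace I' : N → Type _)
        (F x)).open_baseSet.mem_nhds (FiberBundle.mem_baseSet_trivializationAt' (F x))] with y hy
      rw [hV.self_of_nhds]
      simp only [extend]
      rw [h₀, ← Trivialization.symmL_apply (R := ℝ) _ hy, map_zero]
      rfl
    rw [hz, CovariantDerivative.zero]
    rfl
  rw [pullbackCov, h₂, h₃]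
  simp

/-- The section `F_* Y` vanishes near `x`, so its induced derivative is zero. -/
theorem secondFundamentalForm_of_vertical
    (gM : ContMDiffRiemannianMetric I ∞ E (fun x : M ↦ TangentSpace I x))
    (gN : ContMDiffRiemannianMetric I' ∞ E' (fun x : N ↦ TangentSpace I' x))
    {F : M → N} (X : Π x : M, TangentSpace I x) {Y : Π x : M, TangentSpace I x} {x : M}
    (hF : ContinuousAt F x) (hY : ∀ᶠ y in 𝓝 x, Y y ∈ vertical I I' F y) :
    secondFundamentalForm gM gN F X Y x = -mfderiv I I' F x (leviCivita gM Y x (X x)) := by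
  have h : pullbackCov I (leviCivita gN) F (fun y ↦ mfderiv I I' F y (Y y)) x = 0 :=
    pullbackCov_eq_zero _ hF hY
  rw [secondFundamentalForm, h, zero_apply, zero_sub]

end SecondFundamentalForm

/-! ### Integrability of the two distributions -/

section Main

variable {E : Type*} [NormedAddCommGroup E] [NormedSpace ℝ E] [FiniteDimensional ℝ E]
  {M : Type*} [TopologicalSpace M] [ChartedSpace E M] [IsManifold 𝓘(ℝ, E) ∞ M]
  {E' : Type*} [NormedAddCommGroup E'] [NormedSpace ℝ E'] [FiniteDimensional ℝ E']
  {N : Type*} [TopologicalSpace N] [ChartedSpace E' N] [IsManifold 𝓘(ℝ, E') ∞ N]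
  {g : ContMDiffRiemannianMetric 𝓘(ℝ, E) ∞ E (fun x : M ↦ TangentSpace 𝓘(ℝ, E) x)}
  {gN : ContMDiffRiemannianMetric 𝓘(ℝ, E') ∞ E' (fun x : N ↦ TangentSpace 𝓘(ℝ, E') x)}
  {Q : Π x : M, Submodule ℝ (TangentSpace 𝓘(ℝ, E) x →L[ℝ] TangentSpace 𝓘(ℝ, E) x)}
  {F : M → N} {U : Set M}
  {J : Fin 3 → Π x : M, TangentSpace 𝓘(ℝ, E) x →L[ℝ] TangentSpace 𝓘(ℝ, E) x}
  {D₁ : Π x : M, Submodule ℝ (TangentSpace 𝓘(ℝ, E) x)}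

/-- A vector in a smooth distribution extends to a smooth local section. -/
theorem IsSmoothDistributionOn.exists_section (h : IsSmoothDistributionOn D₁ U) {x : M}
    (hx : x ∈ U) {w : TangentSpace 𝓘(ℝ, E) x} (hw : w ∈ D₁ x) :
    ∃ X : Π x : M, TangentSpace 𝓘(ℝ, E) x,
      ContMDiffAt 𝓘(ℝ, E) 𝓘(ℝ, E).tangent ∞ (T% X) x ∧ X x = w ∧ ∀ᶠ y in 𝓝 x, X y ∈ D₁ y := by
  obtain ⟨V, hV, hxV, -, k, X, hX, hspan⟩ := h x hx
  rw [← (hspan x hxV).2, Submodule.mem_span_range_iff_exists_fun] at hw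
  obtain ⟨c, hc⟩ := hw
  -- The coefficients of `w` in the local frame are kept constant.
  refine ⟨fun y ↦ ∑ i, c i • X i y, ?_, hc, ?_⟩
  · exact ContMDiffAt.sum_section fun i _ ↦
      contMDiffAt_const.smul_section ((hX i).contMDiffAt (hV.mem_nhds hxV))
  · filter_upwards [hV.mem_nhds hxV] with y hy
    rw [← (hspan y hy).2]
    exact sum_mem fun i _ ↦ Submodule.smul_mem _ _ (Submodule.subset_span ⟨i, rfl⟩)

theorem mlieBracket_mem_vertical (hF : ContMDiff 𝓘(ℝ, E) 𝓘(ℝ, E') ∞ F)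
    {Y Z : Π x : M, TangentSpace 𝓘(ℝ, E) x} {x : M}
    (hY : MDiffAt (T% Y) x) (hZ : MDiffAt (T% Z) x)
    (hY₀ : ∀ᶠ y in 𝓝 x, Y y ∈ vertical 𝓘(ℝ, E) 𝓘(ℝ, E') F y)
    (hZ₀ : ∀ᶠ y in 𝓝 x, Z y ∈ vertical 𝓘(ℝ, E) 𝓘(ℝ, E') F y) :
    mlieBracket 𝓘(ℝ, E) Y Z x ∈ vertical 𝓘(ℝ, E) 𝓘(ℝ, E') F x :=
  mfderiv_mlieBracket_eq_zero hF hY hZ hY₀ hZ₀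

theorem leviCivita_sub_eq_mlieBracket {Y Z : Π x : M, TangentSpace 𝓘(ℝ, E) x} {x : M}
    (hY : MDiffAt (T% Y) x) (hZ : MDiffAt (T% Z) x) :
    leviCivita g Z x (Y x) - leviCivita g Y x (Z x) = mlieBracket 𝓘(ℝ, E) Y Z x :=
  (CovariantDerivative.torsion_eq_zero_iff _).1 (leviCivita_torsion g) hY hZ

/-- If `g(Y, Z)` vanishes near `x`, then `g(∇_u Y, Z) = -g(Y, ∇_u Z)` at `x`. -/
theorem inner_leviCivita_eq_neg {Y Z : Π x : M, TangentSpace 𝓘(ℝ, E) x} {x : M}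
    (hY : MDiffAt (T% Y) x) (hZ : MDiffAt (T% Z) x)
    (h : ∀ᶠ y in 𝓝 x, g.inner y (Y y) (Z y) = 0) (u : TangentSpace 𝓘(ℝ, E) x) :
    g.inner x (leviCivita g Y x u) (Z x) = -g.inner x (Y x) (leviCivita g Z x u) := by
  have h₁ := leviCivita_metric g (mdifferentiableAt_extend 𝓘(ℝ, E) E u) hY hZ
  have h₂ : (fun y ↦ g.inner y (Y y) (Z y)) =ᶠ[𝓝 x] fun _ ↦ 0 := h
  rw [mvfderiv_congr h₂, mvfderiv_const, extend_apply_self] at h₁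
  have h₃ : 0 = g.inner x (leviCivita g Y x u) (Z x) + g.inner x (Y x) (leviCivita g Z x u) := h₁
  linarith

namespace IsHConformalSemiInvariantBasis

variable (hJ : IsHConformalSemiInvariantBasis 𝓘(ℝ, E') g Q F U J D₁)
include hJ

/-- Applied to `T W = (∇_u J_α) W` with `W ∈ Γ(D₁)`: this term is vertical and does not see `J_α
D₂`. -/
theorem apply_mem {x : M} (hx : x ∈ U) {T : TangentSpace 𝓘(ℝ, E) x →L[ℝ] TangentSpace 𝓘(ℝ, E) x}
    (hT : T ∈ Q x) {v : TangentSpace 𝓘(ℝ, E) x} (hv : v ∈ D₁ x) : T v ∈ D₁ x := by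
  rw [← hJ.basis.span_eq x hx, Submodule.mem_span_range_iff_exists_fun] at hT
  obtain ⟨c, rfl⟩ := hT
  simp only [sum_apply, smul_apply]
  refine sum_mem fun α _ ↦ Submodule.smul_mem _ _ ?_
  rw [← hJ.map_eq x hx α]
  exact ⟨v, hv, rfl⟩

/-- The counterpart for `W ∈ Γ(D₂)`: the error term is horizontal and does not see vertical vectors.
-/
theorem apply_mem_horizontal {x : M} (hx : x ∈ U)
    {T : TangentSpace 𝓘(ℝ, E) x →L[ℝ] TangentSpace 𝓘(ℝ, E) x} (hT : T ∈ Q x)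
    {v : TangentSpace 𝓘(ℝ, E) x} (hv : v ∈ complementInVertical 𝓘(ℝ, E') g F D₁ x) :
    T v ∈ horizontal 𝓘(ℝ, E') g F x := by
  rw [← hJ.basis.span_eq x hx, Submodule.mem_span_range_iff_exists_fun] at hT
  obtain ⟨c, rfl⟩ := hT
  simp only [sum_apply, smul_apply]
  exact sum_mem fun α _ ↦ Submodule.smul_mem _ _ (hJ.map_le x hx α ⟨v, hv, rfl⟩)

theorem isIntegrableOn_complementInVertical (hQ : IsQuaternionicKahler g Q)
    (hF : IsHConformalSubmersion g gN F) (hU : IsOpen U) :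
    IsIntegrableOn (complementInVertical 𝓘(ℝ, E') g F D₁) U := by
  intro Y Z hY hZ x hx
  have hUx : U ∈ 𝓝 x := hU.mem_nhds hx
  have hE : 0 < Module.finrank ℝ E := (Nat.zero_le _).trans_lt hF.finrank_lt
  have hmd {X : Π x : M, TangentSpace 𝓘(ℝ, E) x}
      (hX : ContMDiffAt 𝓘(ℝ, E) 𝓘(ℝ, E).tangent ∞ (T% X) x) :
      MDiffAt (T% X) x := hX.mdifferentiableAt (by simp)
  have hYs := hY.1.contMDiffAt hUx
  have hZs := hZ.1.contMDiffAt hUx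
  have hYv : ∀ᶠ y in 𝓝 x, Y y ∈ vertical 𝓘(ℝ, E) 𝓘(ℝ, E') F y := by
    filter_upwards [hUx] with y hy using (hY.2 y hy).1
  have hZv : ∀ᶠ y in 𝓝 x, Z y ∈ vertical 𝓘(ℝ, E) 𝓘(ℝ, E') F y := by
    filter_upwards [hUx] with y hy using (hZ.2 y hy).1
  have hB := mlieBracket_mem_vertical hF.smooth (hmd hYs) (hmd hZs) hYv hZv
  refine ⟨hB, fun w hw ↦ ?_⟩
  -- the vector `w` is `J₀ X` for a local section `X` of `D₁`
  obtain ⟨w', hw', rfl⟩ := (hJ.map_eq x hx 0).symm ▸ hw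
  obtain ⟨X, hXs, rfl, hXD⟩ := hJ.distribution.exists_section hx hw'
  have hXv : ∀ᶠ y in 𝓝 x, X y ∈ vertical 𝓘(ℝ, E) 𝓘(ℝ, E') F y := by
    filter_upwards [hXD, hUx] with y hy hyU using hJ.le_vertical y hyU hy
  have hJs {W : Π x : M, TangentSpace 𝓘(ℝ, E) x}
      (hW : ContMDiffAt 𝓘(ℝ, E) 𝓘(ℝ, E).tangent ∞ (T% W) x) :=
    hmd (hJ.basis.contMDiffAt_apply hUx 0 hW)
  -- `J₀` may be moved through `∇`, up to terms that are horizontal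
  have hcomm (W W' : Π x : M, TangentSpace 𝓘(ℝ, E) x)
      (hW : ContMDiffAt 𝓘(ℝ, E) 𝓘(ℝ, E).tangent ∞ (T% W) x)
      (hWD : W x ∈ complementInVertical 𝓘(ℝ, E') g F D₁ x)
      (hW' : W' x ∈ vertical 𝓘(ℝ, E) 𝓘(ℝ, E') F x) (u : TangentSpace 𝓘(ℝ, E) x) :
      g.inner x (leviCivita g W x u) (J 0 x (W' x)) =
        -g.inner x (leviCivita g (fun y ↦ J 0 y (W y)) x u) (W' x) := by
    obtain ⟨T, hT, hTW⟩ := hQ.exists_leviCivita_apply_sub_eq hJ.basis hUx hE 0 hW u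
    have h₁ := inner_eq_zero_of_mem_vertical_of_mem_horizontal g hW'
      (hJ.apply_mem_horizontal hx hT hWD)
    have h₂ := hJ.basis.inner_left hx 0 (leviCivita g W x u) (W' x)
    rw [g.symm, ← hTW, map_sub, sub_apply] at h₁
    linarith
  -- horizontality of `J₀ W` for sections `W` of the complement
  have hzero (W W' : Π x : M, TangentSpace 𝓘(ℝ, E) x)
      (hW : IsSectionOn (complementInVertical 𝓘(ℝ, E') g F D₁) U W)
      (hW' : ∀ᶠ y in 𝓝 x, W' y ∈ vertical 𝓘(ℝ, E) 𝓘(ℝ, E') F y) :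
      ∀ᶠ y in 𝓝 x, g.inner y (J 0 y (W y)) (W' y) = 0 := by
    filter_upwards [hW', hUx] with y hy hyU
    rw [g.symm]
    exact inner_eq_zero_of_mem_vertical_of_mem_horizontal g hy
      (hJ.map_le y hyU 0 ⟨_, hW.2 y hyU, rfl⟩)
  -- Together with `e₃` and `e₄`: `g(∇_Y Z, J₀X) = g(J₀Z, ∇_Y X)`, and likewise with `Y` and `Z`
  -- exchanged.
  have e₁ := hcomm Z X hZs (hZ.2 x hx) hXv.self_of_nhds (Y x)
  have e₂ := hcomm Y X hYs (hY.2 x hx) hXv.self_of_nhds (Z x)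
  have e₃ := inner_leviCivita_eq_neg (hJs hZs) (hmd hXs) (hzero Z X hZ hXv) (Y x)
  have e₄ := inner_leviCivita_eq_neg (hJs hYs) (hmd hXs) (hzero Y X hY hXv) (Z x)
  -- exchange the roles of the two arguments by torsion-freeness
  have hswap (W W' : Π x : M, TangentSpace 𝓘(ℝ, E) x)
      (hW : IsSectionOn (complementInVertical 𝓘(ℝ, E') g F D₁) U W)
      (hW's : ContMDiffAt 𝓘(ℝ, E) 𝓘(ℝ, E).tangent ∞ (T% W') x)
      (hW' : ∀ᶠ y in 𝓝 x, W' y ∈ vertical 𝓘(ℝ, E) 𝓘(ℝ, E') F y) :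
      g.inner x (J 0 x (W x)) (leviCivita g X x (W' x)) =
        g.inner x (J 0 x (W x)) (leviCivita g W' x (X x)) := by
    have hb := mlieBracket_mem_vertical hF.smooth (hmd hW's) (hmd hXs) hW' hXv
    have h₁ := inner_eq_zero_of_mem_vertical_of_mem_horizontal g hb
      (hJ.map_le x hx 0 ⟨_, hW.2 x hx, rfl⟩)
    rw [g.symm, ← leviCivita_sub_eq_mlieBracket (g := g) (hmd hW's) (hmd hXs), map_sub] at h₁
    exact sub_eq_zero.1 h₁
  have e₅ := hswap Z Y hZ hYs hYv
  have e₆ := hswap Y Z hY hZs hZv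
  -- With `e₈` and `e₉`: `g(J₀Z, ∇_X Y) = g(J₀Y, ∇_X Z)`. This symmetry makes the two halves of
  -- `g([Y, Z], J₀X)` cancel.
  have e₇ := hcomm Y Z hYs (hY.2 x hx) hZv.self_of_nhds (X x)
  have e₈ := inner_leviCivita_eq_neg (hJs hYs) (hmd hZs) (hzero Y Z hY hZv) (X x)
  have e₉ : g.inner x (J 0 x (Z x)) (leviCivita g Y x (X x)) =
    g.inner x (leviCivita g Y x (X x)) (J 0 x (Z x)) := g.symm _ _ _
  change g.inner x (mlieBracket 𝓘(ℝ, E) Y Z x) (J 0 x (X x)) = 0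
  rw [← leviCivita_sub_eq_mlieBracket (g := g) (hmd hYs) (hmd hZs),
    map_sub (g.inner x) (leviCivita g Z x (Y x)), sub_apply]
  linarith

/-- Both sides reduce to equations indexed by `v ∈ D₂`, and these agree term by term: `g(∇_u (J_α
W), J_α v) = g(∇_u W, v)` for `W ∈ Γ(D₁)`, as `J_α` is an isometry and `(∇_u J_α) W` is vertical. -/
theorem secondFundamentalForm_sub_mem_iff (hQ : IsQuaternionicKahler g Q)
    (hF : IsHConformalSubmersion g gN F) (hU : IsOpen U) (α : Fin 3)
    {Y Z : Π x : M, TangentSpace 𝓘(ℝ, E) x} (hY : IsSectionOn D₁ U Y) (hZ : IsSectionOn D₁ U Z)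
    {x : M} (hx : x ∈ U) :
    secondFundamentalForm g gN F Z (fun y ↦ J α y (Y y)) x
        - secondFundamentalForm g gN F Y (fun y ↦ J α y (Z y)) x ∈
      (mu 𝓘(ℝ, E') g F D₁ (J α) x).map (mfderiv 𝓘(ℝ, E) 𝓘(ℝ, E') F x).toLinearMap ↔
    mlieBracket 𝓘(ℝ, E) Y Z x ∈ D₁ x := by
  have hUx : U ∈ 𝓝 x := hU.mem_nhds hx
  have hE : 0 < Module.finrank ℝ E := (Nat.zero_le _).trans_lt hF.finrank_lt
  have hYs := hY.1.contMDiffAt hUx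
  have hZs := hZ.1.contMDiffAt hUx
  have hv {W : Π x : M, TangentSpace 𝓘(ℝ, E) x} (hW : IsSectionOn D₁ U W) :
      ∀ᶠ y in 𝓝 x, W y ∈ vertical 𝓘(ℝ, E) 𝓘(ℝ, E') F y := by
    filter_upwards [hUx] with y hy using hJ.le_vertical y hy (hW.2 y hy)
  have hJv {W : Π x : M, TangentSpace 𝓘(ℝ, E) x} (hW : IsSectionOn D₁ U W) :
      ∀ᶠ y in 𝓝 x, J α y (W y) ∈ vertical 𝓘(ℝ, E) 𝓘(ℝ, E') F y := by
    filter_upwards [hUx] with y hy using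
      hJ.le_vertical y hy (hJ.apply_mem hy (hJ.basis.mem hy α) (hW.2 y hy))
  have hB := mlieBracket_mem_vertical hF.smooth (hYs.mdifferentiableAt (by simp))
    (hZs.mdifferentiableAt (by simp)) (hv hY) (hv hZ)
  have hFx := hF.smooth.continuous.continuousAt (x := x)
  rw [secondFundamentalForm_of_vertical g gN Z hFx (hJv hY),
    secondFundamentalForm_of_vertical g gN Y hFx (hJv hZ), neg_sub_neg, ← map_sub,
    mfderiv_mem_map_mu_iff g (hJ.map_le x hx α),
    mem_iff_forall_complementInVertical g (hJ.le_vertical x hx) hB]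
  refine forall₂_congr fun v hvD ↦ ?_
  have hcomm {W : Π x : M, TangentSpace 𝓘(ℝ, E) x} (hW : IsSectionOn D₁ U W)
      (u : TangentSpace 𝓘(ℝ, E) x) :
      g.inner x (leviCivita g (fun y ↦ J α y (W y)) x u) (J α x v) =
        g.inner x (leviCivita g W x u) v := by
    obtain ⟨T, hT, hTW⟩ :=
      hQ.exists_leviCivita_apply_sub_eq hJ.basis hUx hE α (hW.1.contMDiffAt hUx) u
    have h₁ := inner_eq_zero_of_mem_vertical_of_mem_horizontal g
      (hJ.le_vertical x hx (hJ.apply_mem hx hT (hW.2 x hx))) (hJ.map_le x hx α ⟨v, hvD, rfl⟩)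
    rw [← hTW, map_sub (g.inner x) _ (J α x _), sub_apply] at h₁
    rw [← hJ.basis.hermitian x hx α _ v]
    exact sub_eq_zero.1 h₁
  rw [← leviCivita_sub_eq_mlieBracket (g := g) (hYs.mdifferentiableAt (by simp))
    (hZs.mdifferentiableAt (by simp)), map_sub (g.inner x), map_sub (g.inner x), sub_apply,
    sub_apply, hcomm hY, hcomm hZ]

theorem isIntegrableOn_iff (hQ : IsQuaternionicKahler g Q)
    (hF : IsHConformalSubmersion g gN F) (hU : IsOpen U) (α : Fin 3) :
    IsIntegrableOn D₁ U ↔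
      SecondFundamentalFormCondition 𝓘(ℝ, E') g gN F U D₁ (J α) :=
  forall₄_congr fun _ _ hY hZ ↦ forall₂_congr fun _ hx ↦
    (hJ.secondFundamentalForm_sub_mem_iff hQ hF hU α hY hZ hx).symm

end IsHConformalSemiInvariantBasis

end Main

end HConformal

theorem mainTheorem12
    {EM : Type*} [NormedAddCommGroup EM] [NormedSpace ℝ EM] [FiniteDimensional ℝ EM]
    {M : Type*} [TopologicalSpace M] [ChartedSpace EM M] [IsManifold 𝓘(ℝ, EM) ∞ M]
    {EN : Type*} [NormedAddCommGroup EN] [NormedSpace ℝ EN] [FiniteDimensional ℝ EN]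
    {N : Type*} [TopologicalSpace N] [ChartedSpace EN N] [IsManifold 𝓘(ℝ, EN) ∞ N]
    (gM : ContMDiffRiemannianMetric 𝓘(ℝ, EM) ∞ EM (fun x : M ↦ TangentSpace 𝓘(ℝ, EM) x))
    (gN : ContMDiffRiemannianMetric 𝓘(ℝ, EN) ∞ EN (fun x : N ↦ TangentSpace 𝓘(ℝ, EN) x))
    (Q : Π x : M, Submodule ℝ (TangentSpace 𝓘(ℝ, EM) x →L[ℝ] TangentSpace 𝓘(ℝ, EM) x))
    (hQ : HConformal.IsQuaternionicKahler gM Q)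
    (F : M → N) (hF : HConformal.IsHConformalSemiInvariantSubmersion gM gN Q F)
    (U : Set M) (hU : IsOpen U)
    (J : Fin 3 → Π x : M, TangentSpace 𝓘(ℝ, EM) x →L[ℝ] TangentSpace 𝓘(ℝ, EM) x)
    (D₁ : Π x : M, Submodule ℝ (TangentSpace 𝓘(ℝ, EM) x))
    (hJ : HConformal.IsHConformalSemiInvariantBasis 𝓘(ℝ, EN) gM Q F U J D₁) :
    HConformal.IsIntegrableOn
      (HConformal.complementInVertical 𝓘(ℝ, EN) gM F D₁) U ∧
    [HConformal.IsIntegrableOn D₁ U,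
      HConformal.SecondFundamentalFormCondition 𝓘(ℝ, EN) gM gN F U D₁ (J 0),
      HConformal.SecondFundamentalFormCondition 𝓘(ℝ, EN) gM gN F U D₁ (J 1),
      HConformal.SecondFundamentalFormCondition 𝓘(ℝ, EN) gM gN F U D₁ (J 2)].TFAE := by
  refine ⟨hJ.isIntegrableOn_complementInVertical hQ hF.toIsHConformalSubmersion hU, ?_⟩
  have h := hJ.isIntegrableOn_iff hQ hF.toIsHConformalSubmersion hU
  tfae_have 1 ↔ 2 := h 0
  tfae_have 1 ↔ 3 := h 1
  tfae_have 1 ↔ 4 := h 2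
  tfae_finish
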